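/- Let $d\in\{1,2,3\}$, $\nu\ge 1/2$, $0<\ell\le (\log 2)^{-1}\sqrt{\nu/(2d)}$, and let $k=C_{\nu,\ell}$ be the Matérn kernel on $\mathbb{R}^d$, $$C_{\nu,\ell}(x)=\frac{2^{1-\nu}}{\Gamma(\nu)}\Bigl(\sqrt{2\nu}\,\frac{|x|}{\ell}\Bigr)^{\nu}K_\nu\Bigl(\sqrt{2\nu}\,\frac{|x|}{\ell}\Bigr)\quad(x\ne 0),\qquad C_{\nu,\ell}(0)=1,$$ where $K_\nu$ is the modified Bessel function of the second kind and $|\cdot|$ the Euclidean norm. Let $\hat k(\xi)=\int_{\mathbb{R}^d}k(x)e^{-2\pi i\langle\xi,x\rangle}\,dx$ and, for $h>0$ and $m\in\mathbb{N}$, let $J_m=\{-m,\dots,m\}^d$ and $$\tilde k(x)=\sum_{j\in J_m}h^d\,\hat k(hj)\,e^{2\pi i h\langle j,x\rangle}.$$ Let $\varepsilon>0$, and let $h>0$ satisfy $$h\le\bigl(1+\sqrt{8\nu}\,\ell\bigr)^{-1}\quad\text{and}\quad h\le\Bigl(1+\ell\sqrt{2d/\nu}\,\log\bigl(d\,3^d/\varepsilon\bigr)\Bigr)^{-1}.$$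 Then the aliasing error is at most $\varepsilon/2$ on $[-1,1]^d$: for every $x\in[-1,1]^d$ the series below converges absolutely and $$\Bigl|\sum_{n\in\mathbb{Z}^d,\ n\ne 0}k\bigl(x+n/h\bigr)\Bigr|\le\varepsilon/2 .$$ If in addition $m\in\mathbb{N}$ satisfies $$m\ge\Bigl(\frac{d\,5^{d-1}}{\pi^{d/2}\,\varepsilon}\Bigr)^{1/(2\nu)}\cdot\frac{1.6\,\sqrt{\nu}}{\pi h\ell},$$ then the truncation error is at most $\varepsilon/2$ on $\mathbb{R}^d$: for every $x\in\mathbb{R}^d$ the series below converges absolutely and $$\Bigl|h^d\sum_{j\in\mathbb{Z}^d,\ j\notin J_m}\hat k(hj)\,e^{2\pi i h\langle j,x\rangle}\Bigr|\le\varepsilon/2 ,$$ and consequently $|\tilde k(x)-k(x)|\le\varepsilon$ for all $x\in[-1,1]^d$. -/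

import Mathlib

open scoped FourierTransform

noncomputable section

/-- The modified Bessel function of the second kind `K_ν(z)`, for real `z > 0`,
through its integral representation. -/
def besselK (ν z : ℝ) : ℝ :=
  ∫ t in Set.Ioi (0 : ℝ), Real.exp (-z * Real.cosh t) * Real.cosh (ν * t)

/-- The Matérn kernel `C_{ν,ℓ}` on `ℝ^d`. The defining formula is of the form `0 · ∞` at the
origin, where the kernel takes its limiting value `1`. -/
def matern {d : ℕ} (ν ℓ : ℝ) (x : EuclideanSpace ℝ (Fin d)) : ℝ :=
  if x = 0 then 1
  else
    (2 : ℝ) ^ (1 - ν) / Real.Gamma ν * (Real.sqrt (2 * ν) * (‖x‖ / ℓ)) ^ ν *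
      besselK ν (Real.sqrt (2 * ν) * (‖x‖ / ℓ))

/-- The integer multi-index `j ∈ ℤ^d` as a point of `ℝ^d`. -/
def latticePoint {d : ℕ} (j : Fin d → ℤ) : EuclideanSpace ℝ (Fin d) :=
  WithLp.toLp 2 fun i => (j i : ℝ)

/-- The box `J_m = {-m, …, m}^d` of multi-indices. -/
def indexBox (d m : ℕ) : Finset (Fin d → ℤ) :=
  Fintype.piFinset fun _ => Finset.Icc (-(m : ℤ)) (m : ℤ)

/-- The Fourier transform `ξ ↦ ∫ k(x) e^{-2πi⟨ξ,x⟩} dx` of a real kernel on `ℝ^d`. -/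
def kernelFourier {d : ℕ} (k : EuclideanSpace ℝ (Fin d) → ℝ) :
    EuclideanSpace ℝ (Fin d) → ℂ :=
  𝓕 fun x => (k x : ℂ)

/-- The Fourier mode `h^d k̂(hj) e^{2πi h⟨j,x⟩}` with multi-index `j`. -/
def fourierMode {d : ℕ} (k : EuclideanSpace ℝ (Fin d) → ℝ) (h : ℝ)
    (x : EuclideanSpace ℝ (Fin d)) (j : Fin d → ℤ) : ℂ :=
  (h : ℂ) ^ d * kernelFourier k (h • latticePoint j) *
    Complex.exp (2 * Real.pi * Complex.I * h * (inner ℝ (latticePoint j) x : ℝ))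

/-- The equispaced Fourier approximation `k̃` of `k`: the sum of the modes in `J_m`. -/
def equispacedFourier {d : ℕ} (k : EuclideanSpace ℝ (Fin d) → ℝ) (h : ℝ) (m : ℕ)
    (x : EuclideanSpace ℝ (Fin d)) : ℂ :=
  ∑ j ∈ indexBox d m, fourierMode k h x j

/-- The terms `k(x + n/h)`, `n ∈ ℤ^d ∖ {0}`, of the aliasing error. -/
def aliasingTerm {d : ℕ} (k : EuclideanSpace ℝ (Fin d) → ℝ) (h : ℝ)
    (x : EuclideanSpace ℝ (Fin d)) (n : {n : Fin d → ℤ // n ≠ 0}) : ℝ :=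
  k (x + h⁻¹ • latticePoint n.1)

/-- The terms `h^d k̂(hj) e^{2πi h⟨j,x⟩}`, `j ∈ ℤ^d ∖ J_m`, of the truncation error. -/
def truncationTerm {d : ℕ} (k : EuclideanSpace ℝ (Fin d) → ℝ) (h : ℝ) (m : ℕ)
    (x : EuclideanSpace ℝ (Fin d)) (j : {j : Fin d → ℤ // j ∉ indexBox d m}) : ℂ :=
  fourierMode k h x j.1

/-- The cube `[-1,1]^d`. -/
def cube (d : ℕ) : Set (EuclideanSpace ℝ (Fin d)) :=
  {x | ∀ i, x i ∈ Set.Icc (-1 : ℝ) 1}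

end

/-!
Substituting `u = exp t` in the integral for `K_ν` shows that the Matérn kernel is the mixture of
the Gaussians `exp(-|x|²/s)` over `s` with a Gamma law of shape `ν` and rate `κ = ν/(2ℓ²)`. Its
Fourier transform is therefore a Gamma integral, and Poisson summation passes to it from the
Gaussian, where it is a product of theta functional equations. Splitting off the term `n = 0` on
the spatial side and the box `J_m` on the frequency side, `k̃ - k` is the aliasing error minus the
truncation error.

* Aliasing: since `-|x|²/s ≤ -2√θ|x| + θs`, the exponential moments of the Gamma law bound the
  kernel by a multiple of `exp(-√κ|x|)` away from the origin; by `∑ |xᵢ| ≤ √d |x|` this is at most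
  a product over the coordinates, whose lattice sum is a product of geometric series.
* Truncation: `|k̂(ξ)|` is at most a multiple of `|ξ|^(-2ν-d)`, and there are
  `O((s+1)^(d-1))` indices in `J_{s+1} ∖ J_s`, so the sum over the shells telescopes. Log-convexity
  of `Γ` reduces the constant to the one in the lower bound on `m`.
-/

open MeasureTheory ProbabilityTheory Real Set

theorem integral_exp_smul_comp_exp {E : Type*} [NormedAddCommGroup E] [NormedSpace ℝ E]
    (g : ℝ → E) : ∫ t, exp t • g (exp t) = ∫ s in Ioi 0, g s := by
  rw [← range_exp, ← image_univ,
    integral_image_eq_integral_abs_deriv_smul .univ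
      (fun t _ => (hasDerivAt_exp t).hasDerivWithinAt) exp_injective.injOn g]
  simp only [abs_exp, setIntegral_univ]

theorem integrable_exp_smul_comp_exp_iff {E : Type*} [NormedAddCommGroup E] [NormedSpace ℝ E]
    (g : ℝ → E) : Integrable (fun t => exp t • g (exp t)) ↔ IntegrableOn g (Ioi 0) := by
  rw [← range_exp, ← image_univ,
    integrableOn_image_iff_integrableOn_abs_deriv_smul .univ
      (fun t _ => (hasDerivAt_exp t).hasDerivWithinAt) exp_injective.injOn g]
  simp only [abs_exp, integrableOn_univ]

theorem integral_eq_integral_Ioi_add_comp_neg {E : Type*} [NormedAddCommGroup E]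
    [NormedSpace ℝ E] {f : ℝ → E} (hf : Integrable f) :
    ∫ t, f t = ∫ t in Ioi 0, (f t + f (-t)) := by
  rw [integral_add hf.integrableOn hf.comp_neg.integrableOn, integral_comp_neg_Ioi, neg_zero,
    ← integral_add_compl measurableSet_Ioi hf, compl_Ioi]

theorem integrableOn_rpow_mul_exp_neg_mul_add_inv {ν z : ℝ} (hν : 0 < ν) (hz : 0 < z) :
    IntegrableOn (fun s => s ^ (ν - 1) * exp (-(z / 2 * (s + s⁻¹)))) (Ioi 0) := by
  have hdom : IntegrableOn (fun s : ℝ => s ^ (ν - 1) * exp (-(z / 2) * s)) (Ioi 0) := by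
    simpa only [rpow_one] using integrableOn_rpow_mul_exp_neg_mul_rpow (p := 1) (s := ν - 1)
      (by linarith) one_pos (half_pos hz)
  refine hdom.mono' (Measurable.aestronglyMeasurable (by fun_prop)) ?_
  filter_upwards [ae_restrict_mem measurableSet_Ioi] with s (hs : 0 < s)
  rw [norm_of_nonneg (by positivity)]
  gcongr
  have : 0 < z / 2 * s⁻¹ := by positivity
  linarith

theorem exp_mul_rpow_mul_exp_neg_mul_add_inv (ν z t : ℝ) :
    exp t • (exp t ^ (ν - 1) * exp (-(z / 2 * (exp t + (exp t)⁻¹)))) =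
      exp (-z * cosh t) * exp (ν * t) := by
  rw [smul_eq_mul, ← exp_mul, ← exp_neg, ← exp_add, ← exp_add, ← exp_add, cosh_eq]
  ring_nf

theorem integral_rpow_mul_exp_neg_mul_add_inv {ν z : ℝ} (hν : 0 < ν) (hz : 0 < z) :
    ∫ s in Ioi 0, s ^ (ν - 1) * exp (-(z / 2 * (s + s⁻¹))) = 2 * besselK ν z := by
  have hint := (integrable_exp_smul_comp_exp_iff _).2
    (integrableOn_rpow_mul_exp_neg_mul_add_inv hν hz)
  rw [← integral_exp_smul_comp_exp, integral_eq_integral_Ioi_add_comp_neg hint, besselK,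
    ← integral_const_mul]
  simp only [exp_mul_rpow_mul_exp_neg_mul_add_inv, cosh_neg, cosh_eq (ν * _), mul_neg]
  congr with t
  ring

theorem integral_rpow_mul_exp_neg_mul_add_div {ν a b : ℝ} (hν : 0 < ν) (ha : 0 < a) (hb : 0 < b) :
    ∫ s in Ioi 0, s ^ (ν - 1) * exp (-(a * s + b / s)) =
      2 * √(b / a) ^ ν * besselK ν (2 * √(a * b)) := by
  set r := √(b / a)
  have hr : 0 < r := by positivity
  have hab : √(a * b) = a * r := by
    rw [sqrt_eq_iff_mul_self_eq (by positivity) (by positivity),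
      show a * r * (a * r) = a ^ 2 * r ^ 2 by ring, sq_sqrt (by positivity)]
    field_simp
  have hb' : b = a * r ^ 2 := by rw [sq_sqrt (by positivity)]; field_simp
  have hscale := integral_comp_mul_left_Ioi' (fun s => s ^ (ν - 1) * exp (-(a * s + b / s))) 0 hr
  rw [mul_zero] at hscale
  rw [← hscale, mul_comm 2, mul_assoc, ← integral_rpow_mul_exp_neg_mul_add_inv hν (by positivity),
    ← integral_const_mul, smul_eq_mul, ← integral_const_mul]
  refine setIntegral_congr_fun measurableSet_Ioi fun s (hs : 0 < s) => ?_
  have hexp : a * (r * s) + b / (r * s) = 2 * √(a * b) / 2 * (s + s⁻¹) := by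
    rw [hab, hb']
    field_simp
  simp only [hexp, mul_rpow hr.le hs.le, rpow_sub_one hr.ne']
  field_simp

section GammaMeasure

variable {a r p θ : ℝ}

theorem toReal_gammaPDF_mul (ha : 0 < a) (hr : 0 < r) (f : ℝ → ℝ) :
    (fun s => (gammaPDF a r s).toReal • f s) = (Ici 0).indicator fun s =>
      r ^ a / Gamma a * (s ^ (a - 1) * exp (-(r * s)) * f s) := by
  ext s
  by_cases hs : 0 ≤ s
  · rw [indicator_of_mem (mem_Ici.2 hs), gammaPDF,
      ENNReal.toReal_ofReal (gammaPDFReal_nonneg ha hr s), gammaPDFReal, if_pos hs]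
    simp only [smul_eq_mul, mul_assoc]
  · rw [indicator_of_notMem (by simpa using hs), gammaPDF_of_neg (not_le.1 hs),
      ENNReal.toReal_zero, zero_smul]

theorem measurable_gammaPDF (a r : ℝ) : Measurable (gammaPDF a r) :=
  (measurable_gammaPDFReal a r).ennreal_ofReal

theorem integral_gammaMeasure (ha : 0 < a) (hr : 0 < r) (f : ℝ → ℝ) :
    ∫ s, f s ∂gammaMeasure a r =
      r ^ a / Gamma a * ∫ s in Ioi 0, s ^ (a - 1) * exp (-(r * s)) * f s := by
  rw [gammaMeasure, integral_withDensity_eq_integral_toReal_smul (measurable_gammaPDF a r)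
      (ae_of_all _ fun _ => ENNReal.ofReal_lt_top), toReal_gammaPDF_mul ha hr,
    integral_indicator measurableSet_Ici, integral_Ici_eq_integral_Ioi, integral_const_mul]

theorem integrable_gammaMeasure_iff (ha : 0 < a) (hr : 0 < r) (f : ℝ → ℝ) :
    Integrable f (gammaMeasure a r) ↔
      IntegrableOn (fun s => s ^ (a - 1) * exp (-(r * s)) * f s) (Ioi 0) := by
  rw [gammaMeasure, integrable_withDensity_iff_integrable_smul' (measurable_gammaPDF a r)
      (ae_of_all _ fun _ => ENNReal.ofReal_lt_top), toReal_gammaPDF_mul ha hr,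
    integrable_indicator_iff measurableSet_Ici, integrableOn_Ici_iff_integrableOn_Ioi,
    IntegrableOn, IntegrableOn, integrable_const_mul_iff]
  exact isUnit_iff_ne_zero.2 (div_pos (by positivity) (Gamma_pos_of_pos ha)).ne'

theorem ae_gammaMeasure_pos (a r : ℝ) : ∀ᵐ s ∂gammaMeasure a r, 0 < s := by
  rw [gammaMeasure, ae_withDensity_iff (measurable_gammaPDF a r)]
  filter_upwards [Measure.ae_ne volume 0] with s hs hne
  exact lt_of_le_of_ne (not_lt.1 fun h => hne (gammaPDF_of_neg h)) hs.symm

theorem rpow_mul_exp_mul_rpow_mul_exp {s : ℝ} (hs : 0 < s) :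
    s ^ (a - 1) * exp (-(r * s)) * (s ^ p * exp (-(θ * s))) =
      s ^ (a + p - 1) * exp (-((r + θ) * s)) := by
  rw [mul_mul_mul_comm, ← rpow_add hs, ← exp_add]
  ring_nf

theorem integrable_rpow_mul_exp_gammaMeasure (ha : 0 < a) (hr : 0 < r) (hp : 0 < a + p)
    (hθ : 0 < r + θ) : Integrable (fun s => s ^ p * exp (-(θ * s))) (gammaMeasure a r) := by
  rw [integrable_gammaMeasure_iff ha hr]
  have hint : IntegrableOn (fun s : ℝ => s ^ (a + p - 1) * exp (-((r + θ) * s))) (Ioi 0) := by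
    simpa only [rpow_one, neg_mul] using integrableOn_rpow_mul_exp_neg_mul_rpow (p := 1)
      (s := a + p - 1) (by linarith) one_pos hθ
  exact hint.congr_fun (fun s hs => (rpow_mul_exp_mul_rpow_mul_exp hs).symm) measurableSet_Ioi

theorem integral_rpow_mul_exp_gammaMeasure (ha : 0 < a) (hr : 0 < r) (hp : 0 < a + p)
    (hθ : 0 < r + θ) : ∫ s, s ^ p * exp (-(θ * s)) ∂gammaMeasure a r =
      r ^ a * (Gamma (a + p) / Gamma a) * (r + θ) ^ (-(a + p)) := by
  rw [integral_gammaMeasure ha hr, setIntegral_congr_fun measurableSet_Ioi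
      fun s (hs : 0 < s) => rpow_mul_exp_mul_rpow_mul_exp hs,
    integral_rpow_mul_exp_neg_mul_Ioi hp hθ, one_div, inv_rpow hθ.le, rpow_neg hθ.le]
  ring

end GammaMeasure

section GaussianMixture

variable {d : ℕ}

/-- The Gaussian kernel `x ↦ exp(-|x|²/s)` on `ℝ^d`. The parameter `s` is four times the usual
heat-kernel time; for `s ≤ 0` it carries no meaning. -/
noncomputable def gaussianKernel (s : ℝ) (x : EuclideanSpace ℝ (Fin d)) : ℝ :=
  exp (-(‖x‖ ^ 2 / s))

/-- The mixture `∫ exp(-|x|²/s) dμ(s)` of Gaussian kernels. -/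
noncomputable def gaussianMixture (μ : Measure ℝ) (x : EuclideanSpace ℝ (Fin d)) : ℝ :=
  ∫ s, gaussianKernel s x ∂μ

theorem gaussianKernel_pos (s : ℝ) (x : EuclideanSpace ℝ (Fin d)) : 0 < gaussianKernel s x :=
  exp_pos _

theorem gaussianMixture_nonneg (μ : Measure ℝ) (x : EuclideanSpace ℝ (Fin d)) :
    0 ≤ gaussianMixture μ x :=
  integral_nonneg fun s => (gaussianKernel_pos s x).le

theorem measurable_uncurry_gaussianKernel :
    Measurable (Function.uncurry (gaussianKernel : ℝ → EuclideanSpace ℝ (Fin d) → ℝ)) := by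
  unfold Function.uncurry gaussianKernel
  fun_prop

theorem integrable_gaussianKernel_param {μ : Measure ℝ} [IsFiniteMeasure μ] (hμ : ∀ᵐ s ∂μ, 0 < s)
    (x : EuclideanSpace ℝ (Fin d)) : Integrable (fun s => gaussianKernel s x) μ := by
  refine .of_bound (measurable_uncurry_gaussianKernel.of_uncurry_right.aestronglyMeasurable) 1 ?_
  filter_upwards [hμ] with s hs
  rw [norm_of_nonneg (gaussianKernel_pos s x).le, gaussianKernel, exp_le_one_iff, neg_nonpos]
  positivity

theorem integral_gaussianKernel {s : ℝ} (hs : 0 < s) :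
    ∫ x : EuclideanSpace ℝ (Fin d), gaussianKernel s x = (π * s) ^ ((d : ℝ) / 2) := by
  simpa only [gaussianKernel, neg_mul, inv_mul_eq_div, div_inv_eq_mul,
    finrank_euclideanSpace_fin] using
    GaussianFourier.integral_rexp_neg_mul_sq_norm (V := EuclideanSpace ℝ (Fin d)) (inv_pos.2 hs)

theorem integrable_gaussianKernel {s : ℝ} (hs : 0 < s) :
    Integrable (gaussianKernel s : EuclideanSpace ℝ (Fin d) → ℝ) :=
  .of_integral_ne_zero (by rw [integral_gaussianKernel hs]; positivity)

theorem kernelFourier_gaussianKernel {s : ℝ} (hs : 0 < s) (ξ : EuclideanSpace ℝ (Fin d)) :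
    kernelFourier (gaussianKernel s) ξ =
      ((π * s) ^ ((d : ℝ) / 2) * exp (-(π ^ 2 * ‖ξ‖ ^ 2 * s)) : ℝ) := by
  have hb : 0 < ((s⁻¹ : ℝ) : ℂ).re := by rwa [Complex.ofReal_re, inv_pos]
  have hcast : (fun x : EuclideanSpace ℝ (Fin d) => (gaussianKernel s x : ℂ)) =
      fun x => Complex.exp (-((s⁻¹ : ℝ) : ℂ) * (‖x‖ : ℂ) ^ 2) := by
    ext x
    rw [gaussianKernel, div_eq_inv_mul]
    push_cast
    rw [neg_mul]
  rw [kernelFourier, hcast, fourier_gaussian_innerProductSpace hb ξ, finrank_euclideanSpace_fin]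
  push_cast [Complex.ofReal_cpow (by positivity : 0 ≤ π * s)]
  congr 2 <;> field_simp

theorem norm_kernelFourier_gaussianKernel {s : ℝ} (hs : 0 < s) (ξ : EuclideanSpace ℝ (Fin d)) :
    ‖kernelFourier (gaussianKernel s) ξ‖ =
      (π * s) ^ ((d : ℝ) / 2) * exp (-(π ^ 2 * ‖ξ‖ ^ 2 * s)) := by
  rw [kernelFourier_gaussianKernel hs, Complex.norm_of_nonneg (by positivity)]

theorem integrable_fourierChar_smul_gaussianKernel {μ : Measure ℝ} (hμ : ∀ᵐ s ∂μ, 0 < s)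
    (hint : Integrable (fun s => s ^ ((d : ℝ) / 2)) μ) (ξ : EuclideanSpace ℝ (Fin d)) :
    Integrable (Function.uncurry fun (s : ℝ) (x : EuclideanSpace ℝ (Fin d)) =>
      𝐞 (-inner ℝ x ξ) • (gaussianKernel s x : ℂ)) (μ.prod volume) := by
  have hmeas : AEStronglyMeasurable (Function.uncurry fun (s : ℝ) (x : EuclideanSpace ℝ (Fin d)) =>
      𝐞 (-inner ℝ x ξ) • (gaussianKernel s x : ℂ)) (μ.prod volume) := by
    refine Measurable.aestronglyMeasurable ?_
    simp only [Function.uncurry_def, Circle.smul_def, smul_eq_mul, Real.fourierChar_apply,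
      gaussianKernel]
    fun_prop
  refine (integrable_prod_iff hmeas).2 ⟨?_, ?_⟩
  · filter_upwards [hμ] with s hs
    exact (Real.fourierIntegral_convergent_iff ξ).2 (integrable_gaussianKernel hs).ofReal
  · refine (hint.const_mul (π ^ ((d : ℝ) / 2))).congr ?_
    filter_upwards [hμ] with s hs
    simp only [Function.uncurry_apply_pair, Circle.norm_smul,
      Complex.norm_of_nonneg (gaussianKernel_pos s _).le]
    rw [integral_gaussianKernel hs, mul_rpow pi_pos.le hs.le]

theorem kernelFourier_gaussianMixture {μ : Measure ℝ} [SFinite μ] (hμ : ∀ᵐ s ∂μ, 0 < s)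
    (hint : Integrable (fun s => s ^ ((d : ℝ) / 2)) μ) (ξ : EuclideanSpace ℝ (Fin d)) :
    kernelFourier (gaussianMixture μ) ξ = ∫ s, kernelFourier (gaussianKernel s) ξ ∂μ := by
  simp only [kernelFourier, Real.fourier_eq]
  rw [integral_integral_swap (integrable_fourierChar_smul_gaussianKernel hμ hint ξ)]
  simp only [gaussianMixture, Circle.smul_def, smul_eq_mul, integral_const_mul,
    integral_complex_ofReal]

end GaussianMixture

section Matern

variable {d : ℕ} {ν ℓ : ℝ}

/-- The rate `ν/(2ℓ²)` of the Gamma law of `s` for which the Matérn kernel is the mixture of the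
`gaussianKernel s`; its square root is the scale of the kernel's exponential decay. -/
noncomputable def maternRate (ν ℓ : ℝ) : ℝ :=
  ν / (2 * ℓ ^ 2)

theorem maternRate_pos (hν : 0 < ν) (hℓ : 0 < ℓ) : 0 < maternRate ν ℓ := by
  unfold maternRate
  positivity

theorem sqrt_maternRate (hℓ : 0 < ℓ) : √(maternRate ν ℓ) = √(2 * ν) / (2 * ℓ) := by
  rw [maternRate, show ν / (2 * ℓ ^ 2) = 2 * ν / (2 * ℓ) ^ 2 by field_simp,
    sqrt_div' _ (by positivity), sqrt_sq (by positivity)]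

theorem matern_eq_gaussianMixture (hν : 0 < ν) (hℓ : 0 < ℓ) :
    (matern ν ℓ : EuclideanSpace ℝ (Fin d) → ℝ) =
      gaussianMixture (gammaMeasure ν (maternRate ν ℓ)) := by
  have hκ := maternRate_pos hν hℓ
  have := isProbabilityMeasure_gammaMeasure hν hκ
  ext x
  rcases eq_or_ne x 0 with rfl | hx
  · simp [matern, gaussianMixture, gaussianKernel]
  have hx' : 0 < ‖x‖ := norm_pos_iff.2 hx
  set κ := maternRate ν ℓ
  have hz : √(2 * ν) * (‖x‖ / ℓ) = 2 * (√κ * ‖x‖) := by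
    rw [sqrt_maternRate hℓ]
    field_simp
  have hbessel := integral_rpow_mul_exp_neg_mul_add_div hν hκ (pow_pos hx' 2)
  rw [sqrt_mul' _ (sq_nonneg _), sqrt_div' _ hκ.le, sqrt_sq hx'.le] at hbessel
  have hpow : κ ^ ν * (‖x‖ / √κ) ^ ν = (√κ * ‖x‖) ^ ν := by
    rw [← mul_rpow hκ.le (by positivity)]
    congr 1
    field_simp
    rw [sq_sqrt hκ.le]
  have hprod : ∀ s, s ^ (ν - 1) * exp (-(κ * s)) * gaussianKernel s x =
      s ^ (ν - 1) * exp (-(κ * s + ‖x‖ ^ 2 / s)) := fun s => by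
    rw [gaussianKernel, mul_assoc, ← exp_add, neg_add]
  rw [gaussianMixture, integral_gammaMeasure hν hκ, funext hprod, hbessel, matern, if_neg hx, hz,
    mul_rpow zero_le_two (by positivity), ← hpow, rpow_sub two_pos, rpow_one]
  field_simp

theorem matern_nonneg (hν : 0 < ν) (hℓ : 0 < ℓ) (x : EuclideanSpace ℝ (Fin d)) :
    0 ≤ matern ν ℓ x := by
  rw [matern_eq_gaussianMixture hν hℓ]
  exact gaussianMixture_nonneg _ x

theorem integrable_rpow_gammaMeasure {a r p : ℝ} (ha : 0 < a) (hr : 0 < r) (hp : 0 < a + p) :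
    Integrable (fun s => s ^ p) (gammaMeasure a r) := by
  simpa using integrable_rpow_mul_exp_gammaMeasure ha hr hp (θ := 0) (by simpa)

theorem kernelFourier_matern (hν : 0 < ν) (hℓ : 0 < ℓ) (ξ : EuclideanSpace ℝ (Fin d)) :
    kernelFourier (matern ν ℓ) ξ =
      (π ^ ((d : ℝ) / 2) * (maternRate ν ℓ ^ ν * (Gamma (ν + d / 2) / Gamma ν) *
        (maternRate ν ℓ + π ^ 2 * ‖ξ‖ ^ 2) ^ (-(ν + d / 2))) : ℝ) := by
  have hκ := maternRate_pos hν hℓ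
  have := isProbabilityMeasure_gammaMeasure hν hκ
  have hpos := ae_gammaMeasure_pos ν (maternRate ν ℓ)
  rw [matern_eq_gaussianMixture hν hℓ, kernelFourier_gaussianMixture hpos
      (integrable_rpow_gammaMeasure hν hκ (by positivity)),
    integral_congr_ae (hpos.mono fun s hs => kernelFourier_gaussianKernel hs ξ),
    integral_complex_ofReal, ← integral_rpow_mul_exp_gammaMeasure hν hκ (by positivity)
      (by positivity), ← integral_const_mul]
  congr 1
  refine integral_congr_ae (hpos.mono fun s hs => ?_)
  simp only [mul_rpow pi_pos.le hs.le, mul_assoc]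

end Matern

section ProductSums

variable {R β : Type*} [NormedField R] {d : ℕ} {f : Fin d → β → R}

theorem summable_norm_prod (hf : ∀ i, Summable fun n => ‖f i n‖) :
    Summable fun n : Fin d → β => ‖∏ i, f i (n i)‖ := by
  induction d with
  | zero => exact .of_finite
  | succ d ih =>
    rw [← (Fin.consEquiv fun _ => β).summable_iff]
    refine ((hf 0).mul_norm (ih fun i => hf i.succ)).congr fun p => ?_
    simp [Fin.prod_univ_succ, Fin.consEquiv]

theorem tsum_prod_eq_prod_tsum [CompleteSpace R] (hf : ∀ i, Summable fun n => ‖f i n‖) :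
    ∑' n : Fin d → β, ∏ i, f i (n i) = ∏ i, ∑' n, f i n := by
  induction d with
  | zero => simp
  | succ d ih =>
    rw [← (Fin.consEquiv fun _ => β).tsum_eq, Fin.prod_univ_succ, ← ih fun i => hf i.succ,
      tsum_mul_tsum_of_summable_norm (hf 0) (summable_norm_prod fun i => hf i.succ)]
    simp [Fin.prod_univ_succ, Fin.consEquiv]

end ProductSums

section Poisson

variable {d : ℕ} {h s : ℝ}

/-- The frequency-`n` term of the Poisson summation of `t ↦ exp(-t²/s)` over `h⁻¹ℤ`. -/
noncomputable def lineGaussianMode (s h t : ℝ) (n : ℤ) : ℂ :=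
  h * ((π * s) ^ (1 / 2 : ℝ) * exp (-(π ^ 2 * (h * n) ^ 2 * s)) : ℝ) *
    Complex.exp (2 * π * Complex.I * h * (n * t : ℝ))

theorem hasSum_exp_neg_add_sq_div (hs : 0 < s) (hh : 0 < h) (t : ℝ) :
    HasSum (fun n : ℤ => exp (-((t + h⁻¹ * n) ^ 2 / s)))
      (HurwitzZeta.evenKernel (h * t : ℝ) (1 / (π * h ^ 2 * s))) := by
  refine (HurwitzZeta.hasSum_int_evenKernel (h * t) (by positivity)).congr_fun fun n => ?_
  congr 1
  field_simp
  ring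

theorem hasSum_lineGaussianMode (hs : 0 < s) (hh : 0 < h) (t : ℝ) :
    HasSum (lineGaussianMode s h t)
      (HurwitzZeta.evenKernel (h * t : ℝ) (1 / (π * h ^ 2 * s)) : ℝ) := by
  have hscale : 1 / (1 / (π * h ^ 2 * s)) ^ (1 / 2 : ℝ) = h * (π * s) ^ (1 / 2 : ℝ) := by
    rw [← sqrt_eq_rpow, ← sqrt_eq_rpow, one_div, one_div, sqrt_inv, inv_inv,
      show π * h ^ 2 * s = h ^ 2 * (π * s) by ring, sqrt_mul (sq_nonneg h), sqrt_sq hh.le]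
  rw [HurwitzZeta.evenKernel_functional_equation, hscale, one_div_one_div, Complex.ofReal_mul]
  refine ((HurwitzZeta.hasSum_int_cosKernel (h * t) (by positivity)).mul_left _).congr_fun
    fun n => ?_
  have hexp : -π * n ^ 2 * (π * h ^ 2 * s) = -(π ^ 2 * (h * n) ^ 2 * s) := by ring
  rw [lineGaussianMode, hexp]
  push_cast
  ring_nf

theorem norm_add_inv_smul_latticePoint_sq (h : ℝ) (x : EuclideanSpace ℝ (Fin d))
    (n : Fin d → ℤ) :
    ‖x + h⁻¹ • latticePoint n‖ ^ 2 = ∑ i, (x i + h⁻¹ * n i) ^ 2 := by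
  simp [EuclideanSpace.norm_sq_eq, latticePoint]

theorem norm_smul_latticePoint_sq (h : ℝ) (n : Fin d → ℤ) :
    ‖h • latticePoint n‖ ^ 2 = ∑ i, (h * n i) ^ 2 := by
  simp [EuclideanSpace.norm_sq_eq, latticePoint, mul_pow]

theorem inner_latticePoint (x : EuclideanSpace ℝ (Fin d)) (n : Fin d → ℤ) :
    inner ℝ (latticePoint n) x = ∑ i, n i * x i := by
  simp [PiLp.inner_apply, latticePoint, mul_comm]

theorem gaussianKernel_translate_eq_prod (s h : ℝ) (x : EuclideanSpace ℝ (Fin d))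
    (n : Fin d → ℤ) :
    gaussianKernel s (x + h⁻¹ • latticePoint n) = ∏ i, exp (-((x i + h⁻¹ * n i) ^ 2 / s)) := by
  rw [gaussianKernel, norm_add_inv_smul_latticePoint_sq, ← exp_sum, Finset.sum_neg_distrib,
    Finset.sum_div]

theorem fourierMode_gaussianKernel_eq_prod (hs : 0 < s) (h : ℝ) (x : EuclideanSpace ℝ (Fin d))
    (j : Fin d → ℤ) :
    fourierMode (gaussianKernel s) h x j = ∏ i, lineGaussianMode s h (x i) (j i) := by
  have hpow : (π * s) ^ ((d : ℝ) / 2) = ((π * s) ^ (1 / 2 : ℝ)) ^ d := by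
    rw [← rpow_natCast, ← rpow_mul (by positivity)]
    ring_nf
  simp only [fourierMode, kernelFourier_gaussianKernel hs, lineGaussianMode,
    Finset.prod_mul_distrib, Finset.prod_const, Finset.card_univ, Fintype.card_fin,
    ← Complex.exp_sum, ← Complex.ofReal_prod, ← exp_sum, Finset.sum_neg_distrib,
    ← Finset.mul_sum, ← Finset.sum_mul, ← Complex.ofReal_sum, norm_smul_latticePoint_sq,
    inner_latticePoint, hpow]

theorem tsum_gaussianKernel_translate (hs : 0 < s) (hh : 0 < h) (x : EuclideanSpace ℝ (Fin d)) :
    ((∑' n, gaussianKernel s (x + h⁻¹ • latticePoint n) : ℝ) : ℂ) =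
      ∑' j, fourierMode (gaussianKernel s) h x j := by
  have hspace := fun i => hasSum_exp_neg_add_sq_div hs hh (x i)
  have hfreq := fun i => hasSum_lineGaussianMode hs hh (x i)
  simp only [gaussianKernel_translate_eq_prod, fourierMode_gaussianKernel_eq_prod hs]
  rw [tsum_prod_eq_prod_tsum fun i => (hspace i).summable.norm,
    tsum_prod_eq_prod_tsum fun i => (hfreq i).summable.norm, Complex.ofReal_prod]
  simp only [(hspace _).tsum_eq, (hfreq _).tsum_eq]

theorem norm_fourierMode (k : EuclideanSpace ℝ (Fin d) → ℝ) (h : ℝ)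
    (x : EuclideanSpace ℝ (Fin d)) (j : Fin d → ℤ) :
    ‖fourierMode k h x j‖ = |h| ^ d * ‖kernelFourier k (h • latticePoint j)‖ := by
  have hphase : 2 * π * Complex.I * h * (inner ℝ (latticePoint j) x : ℝ) =
      ((2 * π * h * inner ℝ (latticePoint j) x : ℝ) : ℂ) * Complex.I := by
    push_cast
    ring
  rw [fourierMode, hphase, norm_mul, norm_mul, Complex.norm_exp_ofReal_mul_I, mul_one, norm_pow,
    Complex.norm_real, norm_eq_abs]

variable {μ : Measure ℝ}

theorem fourierMode_gaussianMixture [SFinite μ] (hμ : ∀ᵐ s ∂μ, 0 < s)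
    (hint : Integrable (fun s => s ^ ((d : ℝ) / 2)) μ) (h : ℝ) (x : EuclideanSpace ℝ (Fin d))
    (j : Fin d → ℤ) :
    fourierMode (gaussianMixture μ) h x j = ∫ s, fourierMode (gaussianKernel s) h x j ∂μ := by
  simp only [fourierMode, kernelFourier_gaussianMixture hμ hint, integral_mul_const,
    integral_const_mul]

theorem norm_kernelFourier_gaussianMixture [SFinite μ] (hμ : ∀ᵐ s ∂μ, 0 < s)
    (hint : Integrable (fun s => s ^ ((d : ℝ) / 2)) μ) (ξ : EuclideanSpace ℝ (Fin d)) :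
    ‖kernelFourier (gaussianMixture μ) ξ‖ = ∫ s, ‖kernelFourier (gaussianKernel s) ξ‖ ∂μ := by
  have hreal : ∀ᵐ s ∂μ, kernelFourier (gaussianKernel s) ξ =
      (‖kernelFourier (gaussianKernel s) ξ‖ : ℂ) :=
    hμ.mono fun s hs => by
      rw [norm_kernelFourier_gaussianKernel hs, kernelFourier_gaussianKernel hs]
  rw [kernelFourier_gaussianMixture hμ hint, integral_congr_ae hreal, integral_complex_ofReal,
    Complex.norm_of_nonneg (integral_nonneg fun _ => norm_nonneg _)]

theorem integrable_kernelFourier_gaussianKernel (hμ : ∀ᵐ s ∂μ, 0 < s)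
    (hint : Integrable (fun s => s ^ ((d : ℝ) / 2)) μ) (ξ : EuclideanSpace ℝ (Fin d)) :
    Integrable (fun s => kernelFourier (gaussianKernel s) ξ) μ := by
  have hbound : Integrable (fun s => (π * s) ^ ((d : ℝ) / 2)) μ :=
    (hint.const_mul (π ^ ((d : ℝ) / 2))).congr
      (hμ.mono fun s hs => (mul_rpow pi_pos.le hs.le).symm)
  have hmeas : AEStronglyMeasurable (fun s => kernelFourier (gaussianKernel s) ξ) μ :=
    (Measurable.aestronglyMeasurable (by fun_prop)).congr
      (hμ.mono fun s hs => (kernelFourier_gaussianKernel hs ξ).symm)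
  refine hbound.mono' hmeas (hμ.mono fun s hs => ?_)
  rw [norm_kernelFourier_gaussianKernel hs]
  exact mul_le_of_le_one_right (by positivity) (exp_le_one_iff.2 (neg_nonpos.2 (by positivity)))

theorem tsum_gaussianMixture_translate [IsFiniteMeasure μ] (hμ : ∀ᵐ s ∂μ, 0 < s)
    (hint : Integrable (fun s => s ^ ((d : ℝ) / 2)) μ) (hh : 0 < h)
    (x : EuclideanSpace ℝ (Fin d))
    (hspace : Summable fun n => gaussianMixture μ (x + h⁻¹ • latticePoint n))
    (hfreq : Summable fun j => ‖fourierMode (gaussianMixture μ) h x j‖) :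
    ((∑' n, gaussianMixture μ (x + h⁻¹ • latticePoint n) : ℝ) : ℂ) =
      ∑' j, fourierMode (gaussianMixture μ) h x j := by
  have hspace' : Summable fun n : Fin d → ℤ =>
      ∫ s, ‖gaussianKernel s (x + h⁻¹ • latticePoint n)‖ ∂μ := by
    simpa only [norm_of_nonneg (gaussianKernel_pos _ _).le, gaussianMixture] using hspace
  have hfreq' : Summable fun j => ∫ s, ‖fourierMode (gaussianKernel s) h x j‖ ∂μ := by
    simpa only [norm_fourierMode, integral_const_mul,
      norm_kernelFourier_gaussianMixture hμ hint] using hfreq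
  have hintMode : ∀ j, Integrable (fun s => fourierMode (gaussianKernel s) h x j) μ := fun j =>
    ((integrable_kernelFourier_gaussianKernel hμ hint _).const_mul _).mul_const _
  calc ((∑' n, gaussianMixture μ (x + h⁻¹ • latticePoint n) : ℝ) : ℂ)
      = ∫ s, ((∑' n, gaussianKernel s (x + h⁻¹ • latticePoint n) : ℝ) : ℂ) ∂μ := by
        rw [integral_complex_ofReal, ← integral_tsum_of_summable_integral_norm
          (fun n => integrable_gaussianKernel_param hμ _) hspace']
        rfl
    _ = ∫ s, ∑' j, fourierMode (gaussianKernel s) h x j ∂μ :=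
        integral_congr_ae (hμ.mono fun s hs => tsum_gaussianKernel_translate hs hh x)
    _ = ∑' j, fourierMode (gaussianMixture μ) h x j := by
        simp only [fourierMode_gaussianMixture hμ hint]
        exact (integral_tsum_of_summable_integral_norm hintMode hfreq').symm

end Poisson

theorem tsum_ne_zero_eq_sub {ι : Type*} [Zero ι] {f : ι → ℝ} (hf : Summable f) :
    ∑' n : {n : ι // n ≠ 0}, f n = ∑' n, f n - f 0 := by
  have hsplit := hf.tsum_subtype_add_tsum_subtype_compl {0}
  rw [tsum_singleton] at hsplit
  exact eq_sub_of_add_eq' hsplit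

theorem summable_of_summable_ne_zero {ι : Type*} [Zero ι] {f : ι → ℝ}
    (hf : Summable fun n : {n : ι // n ≠ 0} => f n) : Summable f :=
  (Set.finite_singleton (0 : ι)).summable_compl_iff.1 hf

section ErrorDecomposition

variable {d m : ℕ} {h : ℝ} {k : EuclideanSpace ℝ (Fin d) → ℝ} {x : EuclideanSpace ℝ (Fin d)}

theorem summable_translate_of_aliasingTerm (hk : Summable (aliasingTerm k h x)) :
    Summable fun n => k (x + h⁻¹ • latticePoint n) :=
  summable_of_summable_ne_zero (f := fun n => k (x + h⁻¹ • latticePoint n)) hk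

theorem summable_fourierMode_of_truncationTerm (hk : Summable (truncationTerm k h m x)) :
    Summable (fourierMode k h x) :=
  (Finset.summable_compl_iff (indexBox d m)).1 hk

theorem equispacedFourier_sub_eq
    (hpoisson : ((∑' n, k (x + h⁻¹ • latticePoint n) : ℝ) : ℂ) = ∑' j, fourierMode k h x j)
    (halias : Summable (aliasingTerm k h x)) (htrunc : Summable (truncationTerm k h m x)) :
    equispacedFourier k h m x - (k x : ℂ) =
      ((∑' n, aliasingTerm k h x n : ℝ) : ℂ) - ∑' j, truncationTerm k h m x j := by
  have hzero : x + h⁻¹ • latticePoint 0 = x := by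
    ext i
    simp [latticePoint]
  have hspace : ∑' n, aliasingTerm k h x n = ∑' n, k (x + h⁻¹ • latticePoint n) - k x := by
    have hsub := tsum_ne_zero_eq_sub (summable_translate_of_aliasingTerm halias)
    rw [hzero] at hsub
    exact hsub
  have hfreq : equispacedFourier k h m x + ∑' j, truncationTerm k h m x j =
      ∑' j, fourierMode k h x j :=
    (summable_fourierMode_of_truncationTerm htrunc).sum_add_tsum_subtype_compl (indexBox d m)
  rw [hspace, Complex.ofReal_sub, hpoisson, ← hfreq]
  ring

end ErrorDecomposition

section ExponentialDecay

variable {d : ℕ}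

theorem gaussianKernel_le_exp {s θ : ℝ} (hs : 0 < s) (hθ : 0 ≤ θ)
    (x : EuclideanSpace ℝ (Fin d)) :
    gaussianKernel s x ≤ exp (-(2 * √θ * ‖x‖)) * exp (θ * s) := by
  rw [gaussianKernel, ← exp_add, exp_le_exp]
  have hsq : θ * s - 2 * √θ * ‖x‖ + ‖x‖ ^ 2 / s = (√θ * s - ‖x‖) ^ 2 / s := by
    field_simp
    rw [sub_sq, mul_pow, sq_sqrt hθ]
    ring
  have hnonneg : 0 ≤ (√θ * s - ‖x‖) ^ 2 / s := by positivity
  linarith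

theorem gaussianMixture_le_exp {μ : Measure ℝ} [IsFiniteMeasure μ] (hμ : ∀ᵐ s ∂μ, 0 < s) {θ : ℝ}
    (hθ : 0 ≤ θ) (hint : Integrable (fun s => exp (θ * s)) μ) (x : EuclideanSpace ℝ (Fin d)) :
    gaussianMixture μ x ≤ exp (-(2 * √θ * ‖x‖)) * ∫ s, exp (θ * s) ∂μ := by
  rw [← integral_const_mul]
  exact integral_mono_ae (integrable_gaussianKernel_param hμ x) (hint.const_mul _)
    (hμ.mono fun s hs => gaussianKernel_le_exp hs hθ x)

theorem integrable_exp_mul_gammaMeasure {a r θ : ℝ} (ha : 0 < a) (hr : 0 < r) (hθ : θ < r) :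
    Integrable (fun s => exp (θ * s)) (gammaMeasure a r) := by
  simpa using integrable_rpow_mul_exp_gammaMeasure ha hr (p := 0) (θ := -θ) (by simpa) (by simpa)

theorem integral_exp_mul_gammaMeasure {a r θ : ℝ} (ha : 0 < a) (hr : 0 < r) (hθ : θ < r) :
    ∫ s, exp (θ * s) ∂gammaMeasure a r = (r / (r - θ)) ^ a := by
  have hmoment := integral_rpow_mul_exp_gammaMeasure ha hr (p := 0) (θ := -θ) (by simpa) (by simpa)
  simp only [rpow_zero, one_mul, neg_mul, neg_neg, add_zero, ← sub_eq_add_neg,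
    div_self (Gamma_pos_of_pos ha).ne', mul_one] at hmoment
  rw [hmoment, rpow_neg (sub_pos.2 hθ).le, div_rpow hr.le (sub_pos.2 hθ).le, div_eq_mul_inv]

theorem sixteen_sevenths_rpow_mul_exp_neg_le {ν : ℝ} (hν : 1 / 2 ≤ ν) :
    (16 / 7) ^ ν * exp (-ν) ≤ 23 / 25 := by
  have hb0 : 0 < 16 / 7 * exp (-1) := by positivity
  have hb : 16 / 7 * exp (-1) ≤ (23 / 25) ^ 2 := by
    rw [exp_neg, ← div_eq_mul_inv, div_le_iff₀ (exp_pos 1)]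
    linarith [exp_one_gt_d9]
  calc (16 / 7) ^ ν * exp (-ν) = (16 / 7 * exp (-1)) ^ ν := by
        rw [mul_rpow (by norm_num) (exp_pos _).le, ← exp_mul, neg_one_mul]
    _ ≤ (16 / 7 * exp (-1)) ^ (1 / 2 : ℝ) :=
        rpow_le_rpow_of_exponent_ge hb0 (hb.trans (by norm_num)) hν
    _ ≤ 23 / 25 := by
        rw [← sqrt_eq_rpow]
        exact sqrt_le_iff.2 ⟨by norm_num, hb⟩

-- The Chernoff parameter `θ = 9κ/16` leaves the decay rate `3√κ/2`, of which one third pays for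
-- the constant.
theorem matern_le_exp {ν ℓ : ℝ} (hν : 1 / 2 ≤ ν) (hℓ : 0 < ℓ) {x : EuclideanSpace ℝ (Fin d)}
    (hx : 2 * ν ≤ √(maternRate ν ℓ) * ‖x‖) :
    matern ν ℓ x ≤ 23 / 25 * exp (-(√(maternRate ν ℓ) * ‖x‖)) := by
  have hν0 : 0 < ν := by linarith
  have hκ := maternRate_pos hν0 hℓ
  set κ := maternRate ν ℓ
  have hθ : 9 / 16 * κ < κ := by linarith
  have := isProbabilityMeasure_gammaMeasure hν0 hκ
  have hroot : √(9 / 16 * κ) = 3 / 4 * √κ := by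
    rw [show 9 / 16 * κ = (3 / 4) ^ 2 * κ by ring, sqrt_mul (sq_nonneg _), sqrt_sq (by norm_num)]
  calc matern ν ℓ x = gaussianMixture (gammaMeasure ν κ) x := by
        rw [matern_eq_gaussianMixture hν0 hℓ]
    _ ≤ exp (-(2 * √(9 / 16 * κ) * ‖x‖)) * (κ / (κ - 9 / 16 * κ)) ^ ν := by
        rw [← integral_exp_mul_gammaMeasure hν0 hκ hθ]
        exact gaussianMixture_le_exp (ae_gammaMeasure_pos ν κ) (by positivity)
          (integrable_exp_mul_gammaMeasure hν0 hκ hθ) x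
    _ = (16 / 7) ^ ν * exp (-(√κ * ‖x‖ / 2) + -(√κ * ‖x‖)) := by
        rw [hroot, show κ / (κ - 9 / 16 * κ) = 16 / 7 by field_simp; norm_num, mul_comm]
        ring_nf
    _ ≤ (16 / 7) ^ ν * exp (-ν + -(√κ * ‖x‖)) := by
        gcongr
        linarith
    _ ≤ 23 / 25 * exp (-(√κ * ‖x‖)) := by
        rw [exp_add, ← mul_assoc]
        gcongr
        exact sixteen_sevenths_rpow_mul_exp_neg_le hν

end ExponentialDecay

section LatticeDecay

variable {a L t : ℝ}

/-- The majorant `exp (-a|t + Ln|)` of an exponentially decaying function on the translated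
lattice `t + Lℤ`, with the term `n = 0` replaced by `1`. -/
noncomputable def latticeDecay (a L t : ℝ) (n : ℤ) : ℝ :=
  if n = 0 then 1 else exp (-(a * |t + L * n|))

theorem latticeDecay_nonneg (n : ℤ) : 0 ≤ latticeDecay a L t n := by
  unfold latticeDecay
  split_ifs <;> positivity

theorem hasSum_latticeDecay (ha : 0 < a) (hL : 0 < L) (ht : |t| ≤ L) :
    HasSum (latticeDecay a L t)
      (1 + (exp (-(a * (L + t))) + exp (-(a * (L - t)))) / (1 - exp (-(a * L)))) := by
  obtain ⟨hlow, hupp⟩ := abs_le.1 ht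
  have hgeom := hasSum_geometric_of_lt_one (exp_pos (-(a * L))).le
    (exp_lt_one_iff.2 (by nlinarith))
  have hpos : ∀ n : ℕ, latticeDecay a L t (n + 1) =
      exp (-(a * (L + t))) * exp (-(a * L)) ^ n := fun n => by
    have hn : 0 ≤ t + L * (n + 1) := by nlinarith [n.cast_nonneg (α := ℝ)]
    rw [latticeDecay, if_neg (by lia), ← exp_nat_mul, ← exp_add]
    push_cast
    rw [abs_of_nonneg hn]
    ring_nf
  have hneg : ∀ n : ℕ, latticeDecay a L t (-(n + 1)) =
      exp (-(a * (L - t))) * exp (-(a * L)) ^ n := fun n => by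
    have hn : t + L * -(n + 1) ≤ 0 := by nlinarith [n.cast_nonneg (α := ℝ)]
    rw [latticeDecay, if_neg (by lia), ← exp_nat_mul, ← exp_add]
    push_cast
    rw [abs_of_nonpos (by simpa using hn)]
    ring_nf
  have htotal := HasSum.of_add_one_of_neg_add_one
    ((hgeom.mul_left (exp (-(a * (L + t))))).congr_fun hpos)
    ((hgeom.mul_left (exp (-(a * (L - t))))).congr_fun hneg)
  rw [show latticeDecay a L t 0 = 1 from if_pos rfl] at htotal
  rw [add_div, div_eq_mul_inv, div_eq_mul_inv, ← add_assoc, add_comm 1]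
  exact htotal

theorem exp_add_exp_le_of_abs_le_one (ha : 0 ≤ a) (ht : |t| ≤ 1) :
    exp (-(a * (L + t))) + exp (-(a * (L - t))) ≤
      exp (-(a * (L - 1))) * (1 + exp (-a) ^ 2) := by
  have hcosh : cosh (a * t) ≤ cosh a := by
    rw [cosh_le_cosh, abs_mul, abs_of_nonneg ha]
    exact mul_le_of_le_one_right ha ht
  calc exp (-(a * (L + t))) + exp (-(a * (L - t))) = 2 * exp (-(a * L)) * cosh (a * t) := by
        rw [cosh_eq, mul_add, neg_add, exp_add, mul_sub, neg_sub, sub_eq_add_neg, exp_add]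
        ring
    _ ≤ 2 * exp (-(a * L)) * cosh a := by gcongr
    _ = exp (-(a * (L - 1))) * (1 + exp (-a) ^ 2) := by
        rw [cosh_eq, ← exp_nat_mul, mul_add, ← exp_add, mul_one, mul_right_comm,
          mul_div_cancel₀ _ two_ne_zero, add_mul, ← exp_add, ← exp_add]
        ring_nf

theorem tsum_latticeDecay_le (ha : log 2 ≤ a) (hL : 1 < L) (ht : |t| ≤ 1) :
    ∑' n, latticeDecay a L t n ≤
      1 + exp (-(a * (L - 1))) * (5 / 4) / (1 - exp (-(a * (L - 1))) / 2) := by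
  have ha0 : 0 < a := (log_pos one_lt_two).trans_le ha
  have hhalf : exp (-a) ≤ 1 / 2 := by
    rw [exp_neg, one_div]
    exact inv_anti₀ two_pos ((log_le_iff_le_exp two_pos).1 ha)
  have hq1 : exp (-(a * (L - 1))) < 1 := exp_lt_one_iff.2 (by nlinarith)
  have hden : exp (-(a * L)) ≤ exp (-(a * (L - 1))) / 2 := by
    rw [show -(a * L) = -(a * (L - 1)) + -a by ring, exp_add, div_eq_mul_one_div]
    gcongr
  rw [(hasSum_latticeDecay ha0 (by linarith) (ht.trans hL.le)).tsum_eq]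
  gcongr 1 + ?_ / (1 - ?_)
  · linarith
  · refine (exp_add_exp_le_of_abs_le_one ha0.le ht).trans ?_
    gcongr
    nlinarith [exp_pos (-a)]

end LatticeDecay

section Aliasing

variable {d : ℕ}

theorem sum_abs_le_sqrt_mul_norm (y : EuclideanSpace ℝ (Fin d)) : ∑ i, |y i| ≤ √d * ‖y‖ := by
  refine le_of_sq_le_sq ?_ (by positivity)
  have hcauchy := sq_sum_le_card_mul_sum_sq (s := Finset.univ) (f := fun i => |y i|)
  rw [mul_pow, sq_sqrt d.cast_nonneg, EuclideanSpace.norm_sq_eq]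
  simpa using hcauchy

theorem add_inv_smul_latticePoint_apply (h : ℝ) (x : EuclideanSpace ℝ (Fin d)) (n : Fin d → ℤ)
    (i : Fin d) : (x + h⁻¹ • latticePoint n) i = x i + h⁻¹ * n i := by
  simp [latticePoint]

theorem inv_sub_one_le_norm {h : ℝ} (hh : 0 < h) {x : EuclideanSpace ℝ (Fin d)} (hx : x ∈ cube d)
    {n : Fin d → ℤ} (hn : n ≠ 0) : h⁻¹ - 1 ≤ ‖x + h⁻¹ • latticePoint n‖ := by
  obtain ⟨i, hi⟩ := Function.ne_iff.1 hn
  have hni : h⁻¹ ≤ |h⁻¹ * n i| := by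
    rw [abs_mul, abs_of_pos (inv_pos.2 hh)]
    exact le_mul_of_one_le_right (inv_pos.2 hh).le (by exact_mod_cast Int.one_le_abs hi)
  calc h⁻¹ - 1 ≤ |h⁻¹ * n i| - |-(x i)| := by
        rw [abs_neg]
        exact sub_le_sub hni (abs_le.2 (hx i))
    _ ≤ |(x + h⁻¹ • latticePoint n) i| := by
        rw [add_inv_smul_latticePoint_apply, add_comm, ← sub_neg_eq_add]
        exact abs_sub_abs_le_abs_sub _ _
    _ ≤ ‖x + h⁻¹ • latticePoint n‖ := by
        simpa only [Real.norm_eq_abs] using PiLp.norm_apply_le (x + h⁻¹ • latticePoint n) i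

theorem exp_neg_sqrt_mul_norm_le_prod {a : ℝ} (ha : 0 ≤ a) (h : ℝ)
    (x : EuclideanSpace ℝ (Fin d)) (n : Fin d → ℤ) :
    exp (-(a * (√d * ‖x + h⁻¹ • latticePoint n‖))) ≤ ∏ i, latticeDecay a h⁻¹ (x i) (n i) := by
  calc exp (-(a * (√d * ‖x + h⁻¹ • latticePoint n‖)))
      ≤ exp (-(a * ∑ i, |(x + h⁻¹ • latticePoint n) i|)) := by
        gcongr
        exact sum_abs_le_sqrt_mul_norm _
    _ = ∏ i, exp (-(a * |x i + h⁻¹ * n i|)) := by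
        rw [← exp_sum, Finset.sum_neg_distrib, Finset.mul_sum]
        simp only [add_inv_smul_latticePoint_apply]
    _ ≤ ∏ i, latticeDecay a h⁻¹ (x i) (n i) := by
        gcongr with i
        unfold latticeDecay
        split_ifs
        · exact exp_le_one_iff.2 (neg_nonpos.2 (by positivity))
        · rfl

theorem summable_and_tsum_aliasingTerm_le {k : EuclideanSpace ℝ (Fin d) → ℝ} {a C h : ℝ}
    {x : EuclideanSpace ℝ (Fin d)} (hk0 : ∀ y, 0 ≤ k y) (hC : 0 ≤ C)
    (hk : ∀ y, h⁻¹ - 1 ≤ ‖y‖ → k y ≤ C * exp (-(a * (√d * ‖y‖))))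
    (ha : log 2 ≤ a) (hh : 1 < h⁻¹) (hx : x ∈ cube d) :
    Summable (aliasingTerm k h x) ∧ ∑' n, aliasingTerm k h x n ≤
      C * ((1 + exp (-(a * (h⁻¹ - 1))) * (5 / 4) / (1 - exp (-(a * (h⁻¹ - 1))) / 2)) ^ d - 1) := by
  have ha0 : 0 < a := (log_pos one_lt_two).trans_le ha
  have hh0 : 0 < h⁻¹ := one_pos.trans hh
  have hx' : ∀ i, |x i| ≤ 1 := fun i => abs_le.2 (hx i)
  have hline : ∀ i, Summable fun n => ‖latticeDecay a h⁻¹ (x i) n‖ := fun i =>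
    (hasSum_latticeDecay ha0 hh0 ((hx' i).trans hh.le)).summable.norm
  have hprod := (summable_norm_prod hline).of_norm
  have hdom : ∀ n, aliasingTerm k h x n ≤ C * ∏ i, latticeDecay a h⁻¹ (x i) (n.1 i) := fun n =>
    (hk _ (inv_sub_one_le_norm (inv_pos.1 hh0) hx n.2)).trans
      (mul_le_mul_of_nonneg_left (exp_neg_sqrt_mul_norm_le_prod ha0.le h x n.1) hC)
  have hmajorant : Summable fun n : {n : Fin d → ℤ // n ≠ 0} =>
      C * ∏ i, latticeDecay a h⁻¹ (x i) (n.1 i) := (hprod.subtype _).mul_left C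
  have hsum := Summable.of_nonneg_of_le (fun n => hk0 _) hdom hmajorant
  refine ⟨hsum, (hsum.tsum_le_tsum hdom hmajorant).trans ?_⟩
  rw [tsum_mul_left, tsum_ne_zero_eq_sub hprod, tsum_prod_eq_prod_tsum hline]
  gcongr
  · rw [← Fin.prod_const]
    gcongr with i
    · exact fun i _ => tsum_nonneg fun n => latticeDecay_nonneg n
    · exact tsum_latticeDecay_le ha hh (hx' i)
  · simp [latticeDecay]

theorem exp_neg_half_le : exp (-(1 / 2)) ≤ 2 / 3 := by
  refine le_of_sq_le_sq ?_ (by norm_num)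
  rw [← exp_nat_mul]
  norm_num
  linarith [exp_neg_one_lt_d9]

theorem mul_div_one_sub_half_le {q b : ℝ} (hb : b < 2) (hq : 0 ≤ q) (hqb : q ≤ b) :
    q * (5 / 4) / (1 - q / 2) ≤ 5 / (4 - 2 * b) * q := by
  rw [div_le_iff₀ (by linarith), div_mul_eq_mul_div, div_mul_eq_mul_div,
    le_div_iff₀ (by linarith)]
  nlinarith

theorem pow_sub_one_le_of_le_exp_neg_inv_sqrt (hd : d = 1 ∨ d = 2 ∨ d = 3) {q : ℝ} (hq0 : 0 ≤ q)
    (hq : q ≤ exp (-(1 / √d))) :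
    23 / 25 * ((1 + q * (5 / 4) / (1 - q / 2)) ^ d - 1) ≤ d * 3 ^ d / 2 * q := by
  by_cases hd1 : d = 1
  · subst hd1
    have hq25 : q ≤ 2 / 5 := by
      norm_num at hq
      linarith [exp_neg_one_lt_d9]
    have hratio := mul_div_one_sub_half_le (by norm_num) hq0 hq25
    norm_num at hratio ⊢
    linarith
  have hsqrt : √(d : ℝ) ≤ 2 := (sqrt_le_left two_pos.le).2 (by norm_cast; lia)
  have hsqrt0 : 0 < √(d : ℝ) := sqrt_pos.2 (by norm_cast; lia)
  have hq23 : q ≤ 2 / 3 := by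
    refine hq.trans (le_trans ?_ exp_neg_half_le)
    gcongr
  have hratio := mul_div_one_sub_half_le (by norm_num) hq0 hq23
  have hratio0 : 0 ≤ q * (5 / 4) / (1 - q / 2) := div_nonneg (by linarith) (by linarith)
  have hpow : ∀ n : ℕ, (1 + q * (5 / 4) / (1 - q / 2)) ^ n ≤ (1 + 15 / 8 * q) ^ n := fun n => by
    norm_num at hratio
    gcongr
  obtain rfl | rfl := hd.resolve_left hd1
  · push_cast
    nlinarith [hpow 2]
  · push_cast
    nlinarith [hpow 3, mul_nonneg hq0 hq0]

theorem log_two_le_sqrt_div {ν ℓ : ℝ} (hℓ : 0 < ℓ)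
    (hℓν : ℓ ≤ (log 2)⁻¹ * √(ν / (2 * d))) : log 2 ≤ √(ν / (2 * d)) / ℓ := by
  rwa [le_div_iff₀ hℓ, ← le_inv_mul_iff₀ (log_pos one_lt_two)]

theorem sqrt_div_mul_sqrt (hd : 0 < d) {ν ℓ : ℝ} (hν : 0 ≤ ν) (hℓ : 0 < ℓ) :
    √(ν / (2 * d)) / ℓ * √d = √(maternRate ν ℓ) := by
  rw [maternRate, div_mul_eq_mul_div, ← sqrt_mul (by positivity),
    show ν / (2 * d) * d = ν / 2 by field_simp, ← div_div, sqrt_div' _ (sq_nonneg ℓ), sqrt_sq hℓ.le]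

theorem two_mul_le_sqrt_maternRate_mul {ν ℓ r : ℝ} (hν : 0 ≤ ν) (hℓ : 0 < ℓ)
    (hr : √(8 * ν) * ℓ ≤ r) : 2 * ν ≤ √(maternRate ν ℓ) * r := by
  calc 2 * ν = √(2 * ν) / (2 * ℓ) * (√(8 * ν) * ℓ) := by
        rw [div_mul_eq_mul_div, ← mul_assoc, ← sqrt_mul (by positivity),
          show 2 * ν * (8 * ν) = (4 * ν) ^ 2 by ring, sqrt_sq (by positivity)]
        field_simp
        ring
    _ ≤ √(2 * ν) / (2 * ℓ) * r := by gcongr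
    _ = √(maternRate ν ℓ) * r := by rw [sqrt_maternRate hℓ]

theorem exp_neg_mul_inv_sub_one_le (hd : 0 < d) {ν ℓ ε h : ℝ} (hν : 0 < ν) (hℓ : 0 < ℓ)
    (hε : 0 < ε) (hh : 0 < h) (hhε : h ≤ (1 + ℓ * √(2 * d / ν) * log (d * 3 ^ d / ε))⁻¹) :
    exp (-(√(ν / (2 * d)) / ℓ * (h⁻¹ - 1))) ≤ ε / (d * 3 ^ d) := by
  have hinv : 1 + ℓ * √(2 * d / ν) * log (d * 3 ^ d / ε) ≤ h⁻¹ :=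
    (le_inv_comm₀ (inv_pos.1 (hh.trans_le hhε)) hh).2 hhε
  have hsqrt : √(ν / (2 * d)) * √(2 * d / ν) = 1 := by
    rw [← sqrt_mul (by positivity), div_mul_div_cancel₀ (by positivity), div_self hν.ne', sqrt_one]
  have hlog : log (d * 3 ^ d / ε) ≤ √(ν / (2 * d)) / ℓ * (h⁻¹ - 1) := by
    calc log (d * 3 ^ d / ε)
        = √(ν / (2 * d)) / ℓ * (ℓ * √(2 * d / ν) * log (d * 3 ^ d / ε)) := by
          rw [← mul_assoc, ← mul_assoc, div_mul_cancel₀ _ hℓ.ne', hsqrt, one_mul]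
      _ ≤ √(ν / (2 * d)) / ℓ * (h⁻¹ - 1) := by
          gcongr
          linarith
  calc exp (-(√(ν / (2 * d)) / ℓ * (h⁻¹ - 1))) ≤ exp (-log (d * 3 ^ d / ε)) := by gcongr
    _ = ε / (d * 3 ^ d) := by rw [exp_neg, exp_log (by positivity), inv_div]

theorem exp_neg_mul_inv_sub_one_le_exp_neg_inv_sqrt (hd : 0 < d) {ν ℓ h : ℝ} (hν : 1 / 2 ≤ ν)
    (hℓ : 0 < ℓ) (hh : √(8 * ν) * ℓ ≤ h⁻¹ - 1) :
    exp (-(√(ν / (2 * d)) / ℓ * (h⁻¹ - 1))) ≤ exp (-(1 / √d)) := by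
  have hsqrt : 0 < √(d : ℝ) := sqrt_pos.2 (Nat.cast_pos.2 hd)
  gcongr
  rw [div_le_iff₀ hsqrt, mul_right_comm, sqrt_div_mul_sqrt hd (by linarith) hℓ]
  linarith [two_mul_le_sqrt_maternRate_mul (by linarith) hℓ hh]

theorem matern_aliasing_error (hd : d = 1 ∨ d = 2 ∨ d = 3) {ν ℓ ε h : ℝ} (hν : 1 / 2 ≤ ν)
    (hℓ : 0 < ℓ) (hℓν : ℓ ≤ (log 2)⁻¹ * √(ν / (2 * d))) (hε : 0 < ε) (hh : 0 < h)
    (hhℓ : h ≤ (1 + √(8 * ν) * ℓ)⁻¹)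
    (hhε : h ≤ (1 + ℓ * √(2 * d / ν) * log (d * 3 ^ d / ε))⁻¹)
    {x : EuclideanSpace ℝ (Fin d)} (hx : x ∈ cube d) :
    Summable (aliasingTerm (matern ν ℓ) h x) ∧
      |∑' n, aliasingTerm (matern ν ℓ) h x n| ≤ ε / 2 := by
  have hd0 : 0 < d := by lia
  have hν0 : 0 < ν := by linarith
  have hfar : √(8 * ν) * ℓ ≤ h⁻¹ - 1 := by
    have := (le_inv_comm₀ (by positivity) hh).2 hhℓ
    linarith
  have hh1 : 1 < h⁻¹ := by
    have : 0 < √(8 * ν) * ℓ := by positivity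
    linarith
  have hdecay : ∀ y : EuclideanSpace ℝ (Fin d), h⁻¹ - 1 ≤ ‖y‖ →
      matern ν ℓ y ≤ 23 / 25 * exp (-(√(ν / (2 * d)) / ℓ * (√d * ‖y‖))) := fun y hy => by
    rw [← mul_assoc, sqrt_div_mul_sqrt hd0 hν0.le hℓ]
    exact matern_le_exp hν hℓ (two_mul_le_sqrt_maternRate_mul hν0.le hℓ (hfar.trans hy))
  obtain ⟨hsum, hle⟩ := summable_and_tsum_aliasingTerm_le (matern_nonneg hν0 hℓ) (by norm_num)
    hdecay (log_two_le_sqrt_div hℓ hℓν) hh1 hx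
  refine ⟨hsum, ?_⟩
  have hnonneg : 0 ≤ ∑' n, aliasingTerm (matern ν ℓ) h x n :=
    tsum_nonneg fun n => matern_nonneg hν0 hℓ _
  rw [abs_of_nonneg hnonneg]
  refine hle.trans ((pow_sub_one_le_of_le_exp_neg_inv_sqrt hd (exp_pos _).le
    (exp_neg_mul_inv_sub_one_le_exp_neg_inv_sqrt hd0 hν hℓ hfar)).trans ?_)
  calc (d * 3 ^ d / 2 * exp (-(√(ν / (2 * d)) / ℓ * (h⁻¹ - 1))) : ℝ)
      ≤ d * 3 ^ d / 2 * (ε / (d * 3 ^ d)) := by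
        gcongr
        exact exp_neg_mul_inv_sub_one_le hd0 hν0 hℓ hε hh hhε
    _ = ε / 2 := by
        have : (d : ℝ) ≠ 0 := Nat.cast_ne_zero.2 hd0.ne'
        field_simp

end Aliasing

theorem summable_and_tsum_compl_le_of_sum_sdiff_le {α : Type*} [DecidableEq α] {B : ℕ → Finset α}
    {g : α → ℝ} {u : ℕ → ℝ} {m : ℕ} (hB : Monotone B) (hcover : ∀ a, ∃ n, a ∈ B n)
    (hg : ∀ a, 0 ≤ g a) (hu : ∀ n, 0 ≤ u n)
    (hshell : ∀ n, m ≤ n → ∑ a ∈ B (n + 1) \ B n, g a ≤ u n - u (n + 1)) :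
    (Summable fun a : {a // a ∉ B m} => g a) ∧ ∑' a : {a // a ∉ B m}, g a ≤ u m := by
  have htelescope : ∀ n, m ≤ n → ∑ a ∈ B n \ B m, g a ≤ u m - u n := fun n hn => by
    induction n, hn using Nat.le_induction with
    | base => simp
    | succ n hn ih =>
      rw [← Finset.sdiff_union_sdiff_cancel (hB n.le_succ) (hB hn), Finset.sum_union]
      · linarith [hshell n hn]
      · exact Finset.sdiff_disjoint.mono_right Finset.sdiff_subset
  have hfinite : ∀ U : Finset {a // a ∉ B m}, ∑ a ∈ U, g a ≤ u m := fun U => by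
    have hB_top := Filter.tendsto_atTop_finset_of_monotone hB hcover
    obtain ⟨n, hUn, hmn⟩ := ((hB_top.eventually_ge_atTop (U.map (.subtype _))).and
      (Filter.eventually_ge_atTop m)).exists
    calc ∑ a ∈ U, g a = ∑ a ∈ U.map (.subtype _), g a := by simp
      _ ≤ ∑ a ∈ B n \ B m, g a := by
          refine Finset.sum_le_sum_of_subset_of_nonneg (fun a ha => ?_) fun a _ _ => hg a
          obtain ⟨b, -, rfl⟩ := Finset.mem_map.1 ha
          exact Finset.mem_sdiff.2 ⟨hUn ha, b.2⟩
      _ ≤ u m := (htelescope n hmn).trans (sub_le_self _ (hu n))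
  have hsum := summable_of_sum_le (fun a : {a // a ∉ B m} => hg a) hfinite
  exact ⟨hsum, hsum.tsum_le_of_sum_le hfinite⟩

theorem mul_rpow_neg_succ_le_sub {p t : ℝ} (hp : 0 ≤ p) (ht : 0 < t) :
    p * (t + 1) ^ (-(p + 1)) ≤ t ^ (-p) - (t + 1) ^ (-p) := by
  have ht1 : 0 < t + 1 := by linarith
  have hbernoulli : 1 + p * (1 / (t + 1)) ≤ (t / (t + 1)) ^ (-p) := by
    have hlog : log (t / (t + 1)) ≤ -(1 / (t + 1)) :=
      (log_le_sub_one_of_pos (by positivity)).trans_eq (by field_simp; ring)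
    rw [rpow_def_of_pos (by positivity), add_comm]
    exact (add_le_add_left (by nlinarith) 1).trans (add_one_le_exp _)
  calc p * (t + 1) ^ (-(p + 1))
      = (t + 1) ^ (-p) * (1 + p * (1 / (t + 1))) - (t + 1) ^ (-p) := by
        rw [show -(p + 1) = -p - 1 by ring, rpow_sub_one ht1.ne']
        ring
    _ ≤ (t + 1) ^ (-p) * (t / (t + 1)) ^ (-p) - (t + 1) ^ (-p) := by gcongr
    _ = t ^ (-p) - (t + 1) ^ (-p) := by
        rw [← mul_rpow ht1.le (by positivity), mul_div_cancel₀ _ ht1.ne']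

section Truncation

variable {d : ℕ}

theorem mem_indexBox {m : ℕ} {j : Fin d → ℤ} : j ∈ indexBox d m ↔ ∀ i, |j i| ≤ m := by
  simp [indexBox, abs_le]

theorem monotone_indexBox (d : ℕ) : Monotone (indexBox d) := fun m n hmn j hj =>
  mem_indexBox.2 fun i => (mem_indexBox.1 hj i).trans (by exact_mod_cast hmn)

theorem exists_mem_indexBox (j : Fin d → ℤ) : ∃ m, j ∈ indexBox d m := by
  refine ⟨Finset.univ.sup fun i => (j i).natAbs, mem_indexBox.2 fun i => ?_⟩
  rw [Int.abs_eq_natAbs]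
  exact_mod_cast Finset.le_sup (f := fun i => (j i).natAbs) (Finset.mem_univ i)

theorem card_indexBox (d m : ℕ) : (indexBox d m).card = (2 * m + 1) ^ d := by
  rw [indexBox, Fintype.card_piFinset_const, Int.card_Icc]
  congr 1
  lia

theorem card_indexBox_succ_sdiff_le (d s : ℕ) :
    ((indexBox d (s + 1) \ indexBox d s).card : ℝ) ≤ 2 * d * 3 ^ (d - 1) * (s + 1) ^ (d - 1) := by
  calc ((indexBox d (s + 1) \ indexBox d s).card : ℝ)
      = (2 * s + 3) ^ d - (2 * s + 1) ^ d := by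
        rw [Finset.cast_card_sdiff (monotone_indexBox d s.le_succ), card_indexBox, card_indexBox]
        push_cast
        ring
    _ ≤ |(2 * s + 3 : ℝ) - (2 * s + 1)| * d * max |(2 * s + 3 : ℝ)| |(2 * s + 1 : ℝ)| ^ (d - 1) :=
        (le_abs_self _).trans (abs_pow_sub_pow_le _ _ d)
    _ = 2 * d * (2 * s + 3) ^ (d - 1) := by
        rw [abs_of_nonneg (by positivity : (0 : ℝ) ≤ 2 * s + 3),
          abs_of_nonneg (by positivity : (0 : ℝ) ≤ 2 * s + 1), max_eq_left (by linarith)]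
        norm_num
    _ ≤ 2 * d * (3 * (s + 1)) ^ (d - 1) := by
        gcongr
        linarith
    _ = 2 * d * 3 ^ (d - 1) * (s + 1) ^ (d - 1) := by
        rw [mul_pow]
        ring

theorem sum_indexBox_succ_sdiff_le (hd : 0 < d) {C p : ℝ} (hC : 0 ≤ C) (hp : 0 < p)
    {g : (Fin d → ℤ) → ℝ} {s : ℕ} (hs : 0 < s)
    (hg : ∀ j ∉ indexBox d s, g j ≤ C * (s + 1 : ℝ) ^ (-(p + d))) :
    ∑ j ∈ indexBox d (s + 1) \ indexBox d s, g j ≤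
      2 * d * 3 ^ (d - 1) / p * C * ((s : ℝ) ^ (-p) - (s + 1 : ℝ) ^ (-p)) := by
  have hpow : (s + 1 : ℝ) ^ (d - 1) * (s + 1 : ℝ) ^ (-(p + d)) = (s + 1 : ℝ) ^ (-(p + 1)) := by
    rw [← rpow_natCast, ← rpow_add (by positivity), Nat.cast_sub hd]
    push_cast
    ring_nf
  calc ∑ j ∈ indexBox d (s + 1) \ indexBox d s, g j
      ≤ (indexBox d (s + 1) \ indexBox d s).card • (C * (s + 1 : ℝ) ^ (-(p + d))) :=
        Finset.sum_le_card_nsmul _ _ _ fun j hj => hg j (Finset.mem_sdiff.1 hj).2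
    _ ≤ 2 * d * 3 ^ (d - 1) * (s + 1) ^ (d - 1) * (C * (s + 1 : ℝ) ^ (-(p + d))) := by
        rw [nsmul_eq_mul]
        gcongr
        exact card_indexBox_succ_sdiff_le d s
    _ = 2 * d * 3 ^ (d - 1) / p * C * (p * (s + 1 : ℝ) ^ (-(p + 1))) := by
        rw [← hpow]
        field_simp
    _ ≤ 2 * d * 3 ^ (d - 1) / p * C * ((s : ℝ) ^ (-p) - (s + 1 : ℝ) ^ (-p)) := by
        gcongr
        exact mul_rpow_neg_succ_le_sub hp.le (Nat.cast_pos.2 hs)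

theorem succ_le_norm_latticePoint {s : ℕ} {j : Fin d → ℤ} (hj : j ∉ indexBox d s) :
    (s + 1 : ℝ) ≤ ‖latticePoint j‖ := by
  obtain ⟨i, hi⟩ := not_forall.1 (mem_indexBox.not.1 hj)
  calc (s + 1 : ℝ) ≤ |(j i : ℝ)| := by exact_mod_cast not_le.1 hi
    _ ≤ ‖latticePoint j‖ := PiLp.norm_apply_le (latticePoint j) i

theorem norm_fourierMode_le {k : EuclideanSpace ℝ (Fin d) → ℝ} {C p h : ℝ} (hC : 0 ≤ C)
    (hp : 0 ≤ p) (hh : 0 < h) (hk : ∀ ξ ≠ 0, ‖kernelFourier k ξ‖ ≤ C * ‖ξ‖ ^ (-(p + d)))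
    (x : EuclideanSpace ℝ (Fin d)) {s : ℕ} {j : Fin d → ℤ} (hj : j ∉ indexBox d s) :
    ‖fourierMode k h x j‖ ≤ C * h ^ (-p) * (s + 1 : ℝ) ^ (-(p + d)) := by
  have hnorm : h * (s + 1) ≤ ‖h • latticePoint j‖ := by
    rw [norm_smul, norm_of_nonneg hh.le]
    gcongr
    exact succ_le_norm_latticePoint hj
  have hne : h • latticePoint j ≠ 0 := norm_pos_iff.1 (lt_of_lt_of_le (by positivity) hnorm)
  calc ‖fourierMode k h x j‖ = h ^ d * ‖kernelFourier k (h • latticePoint j)‖ := by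
        rw [norm_fourierMode, abs_of_pos hh]
    _ ≤ h ^ d * (C * (h * (s + 1)) ^ (-(p + d))) := by
        gcongr
        refine (hk _ hne).trans (mul_le_mul_of_nonneg_left ?_ hC)
        exact rpow_le_rpow_of_nonpos (by positivity) hnorm (neg_nonpos.2 (by positivity))
    _ = C * h ^ (-p) * (s + 1 : ℝ) ^ (-(p + d)) := by
        have hpow : h ^ d * h ^ (-(p + d)) = h ^ (-p) := by
          rw [← rpow_natCast, ← rpow_add hh]
          ring_nf
        rw [mul_rpow hh.le (by positivity), ← hpow]
        ring

theorem summable_and_norm_tsum_truncationTerm_le (hd : 0 < d) {k : EuclideanSpace ℝ (Fin d) → ℝ}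
    {C p h : ℝ} (hC : 0 ≤ C) (hp : 0 < p) (hh : 0 < h)
    (hk : ∀ ξ ≠ 0, ‖kernelFourier k ξ‖ ≤ C * ‖ξ‖ ^ (-(p + d))) {m : ℕ} (hm : 0 < m)
    (x : EuclideanSpace ℝ (Fin d)) :
    Summable (truncationTerm k h m x) ∧ ‖∑' j, truncationTerm k h m x j‖ ≤
      2 * d * 3 ^ (d - 1) / p * (C * (h * m) ^ (-p)) := by
  obtain ⟨hsum, hle⟩ := summable_and_tsum_compl_le_of_sum_sdiff_le (m := m) (B := indexBox d)
    (g := fun j => ‖fourierMode k h x j‖)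
    (u := fun s => 2 * d * 3 ^ (d - 1) / p * (C * h ^ (-p)) * (s : ℝ) ^ (-p))
    (monotone_indexBox d) exists_mem_indexBox (fun j => norm_nonneg _) (fun s => by positivity)
    fun s hs => by
      rw [← mul_sub]
      push_cast
      exact sum_indexBox_succ_sdiff_le hd (by positivity) hp (hm.trans_le hs)
        fun j hj => norm_fourierMode_le hC hp.le hh hk x hj
  refine ⟨hsum.of_norm, (norm_tsum_le_tsum_norm hsum).trans (hle.trans_eq ?_)⟩
  rw [mul_rpow hh.le m.cast_nonneg]
  ring

end Truncation

section GammaBounds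

theorem convexOn_add_le_add {f : ℝ → ℝ} {s : Set ℝ} (hf : ConvexOn ℝ s f) {x y a : ℝ}
    (hx : x ∈ s) (hya : y + a ∈ s) (hxy : x ≤ y) (ha : 0 ≤ a) :
    f (x + a) + f y ≤ f x + f (y + a) := by
  rcases (add_nonneg (sub_nonneg.2 hxy) ha).eq_or_lt with h0 | hpos
  · obtain rfl : a = 0 := by linarith
    obtain rfl : x = y := by linarith
    simp
  have hw : (y - x) / (y - x + a) + a / (y - x + a) = 1 := by
    rw [← add_div, div_self hpos.ne']
  have hw₁ : 0 ≤ (y - x) / (y - x + a) := div_nonneg (sub_nonneg.2 hxy) hpos.le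
  have hw₂ : 0 ≤ a / (y - x + a) := div_nonneg ha hpos.le
  have hleft := hf.2 hx hya hw₁ hw₂ hw
  have hright := hf.2 hx hya hw₂ hw₁ (by rw [add_comm, hw])
  simp only [smul_eq_mul] at hleft hright
  rw [show (y - x) / (y - x + a) * x + a / (y - x + a) * (y + a) = x + a by
    field_simp; ring] at hleft
  rw [show a / (y - x + a) * x + (y - x) / (y - x + a) * (y + a) = y by
    field_simp; ring] at hright
  linear_combination hleft + hright + (f x + f (y + a)) * hw

theorem Gamma_add_mul_Gamma_le {x y a : ℝ} (hx : 0 < x) (hxy : x ≤ y) (ha : 0 ≤ a) :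
    Gamma (x + a) * Gamma y ≤ Gamma x * Gamma (y + a) := by
  have hy : 0 < y := hx.trans_le hxy
  have hne : ∀ {t : ℝ}, 0 < t → Gamma t ≠ 0 := fun ht => (Gamma_pos_of_pos ht).ne'
  rw [← log_le_log_iff (by positivity) (by positivity), log_mul (hne (by positivity)) (hne hy),
    log_mul (hne hx) (hne (by positivity))]
  exact convexOn_add_le_add convexOn_log_Gamma hx (add_pos_of_pos_of_nonneg hy ha) hxy ha

-- `5.12 = 2 * 1.6 ^ 2` comes from the factor `1.6` in the lower bound on `m`.
theorem two_mul_Gamma_add_half_le {ν : ℝ} (hν : 1 / 2 ≤ ν) :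
    2 * Gamma (ν + 1 / 2) ≤ 5.12 ^ ν * Gamma (ν + 1) := by
  have hconvex : √π / 2 * Gamma (ν + 1 / 2) ≤ Gamma (ν + 1) := by
    have h := Gamma_add_mul_Gamma_le one_pos (by linarith : 1 ≤ ν + 1 / 2) one_half_pos.le
    rw [Gamma_one, one_mul, add_comm 1, Gamma_add_one one_half_pos.ne', Gamma_one_half_eq] at h
    ring_nf at h ⊢
    exact h
  have hconst : 4 ≤ 5.12 ^ ν * √π := by
    calc (4 : ℝ) ≤ √5.12 * √π := by
          rw [← sqrt_mul (by norm_num)]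
          exact le_sqrt_of_sq_le (by linarith [pi_gt_d2])
      _ ≤ 5.12 ^ ν * √π := by
          rw [sqrt_eq_rpow]
          gcongr
          norm_num
  calc 2 * Gamma (ν + 1 / 2) ≤ 5.12 ^ ν * √π / 2 * Gamma (ν + 1 / 2) := by
        gcongr
        linarith
    _ = 5.12 ^ ν * (√π / 2 * Gamma (ν + 1 / 2)) := by ring
    _ ≤ 5.12 ^ ν * Gamma (ν + 1) := by gcongr

theorem Gamma_add_three_halves_le {ν : ℝ} (hν : 0 ≤ ν) :
    Gamma (ν + 3 / 2) ≤ 5.12 ^ ν * Gamma (ν + 1) := by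
  have hΓ := Gamma_pos_of_pos (by linarith : 0 < ν + 1)
  have hconvex : Gamma (ν + 3 / 2) ^ 2 ≤ (ν + 1) * Gamma (ν + 1) ^ 2 := by
    have h := Gamma_add_mul_Gamma_le (by linarith : 0 < ν + 1)
      (by linarith : ν + 1 ≤ ν + 3 / 2) one_half_pos.le
    rw [show ν + 1 + 1 / 2 = ν + 3 / 2 by ring, show ν + 3 / 2 + 1 / 2 = ν + 1 + 1 by ring,
      Gamma_add_one (by linarith : ν + 1 ≠ 0)] at h
    linarith
  have hlinear : Gamma (ν + 3 / 2) ≤ (ν + 1) * Gamma (ν + 1) :=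
    le_of_sq_le_sq (by nlinarith [pow_pos hΓ 2]) (by positivity)
  refine hlinear.trans ?_
  gcongr
  calc ν + 1 ≤ exp 1 ^ ν := by
        rw [← exp_mul, one_mul]
        exact add_one_le_exp ν
    _ ≤ 5.12 ^ ν := by
        gcongr
        linarith [exp_one_lt_d9]

theorem two_mul_three_pow_mul_Gamma_le {d : ℕ} (hd : d = 1 ∨ d = 2 ∨ d = 3) {ν : ℝ}
    (hν : 1 / 2 ≤ ν) :
    2 * 3 ^ (d - 1) * Gamma (ν + d / 2) ≤ 5 ^ (d - 1) * (5.12 ^ ν * Gamma (ν + 1)) := by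
  have hΓ := Gamma_pos_of_pos (by linarith : 0 < ν + 1)
  rcases hd with rfl | rfl | rfl
  · simpa using two_mul_Gamma_add_half_le hν
  · have hpow : (2 : ℝ) ≤ 5.12 ^ ν := by
      calc (2 : ℝ) ≤ √5.12 := le_sqrt_of_sq_le (by norm_num)
        _ ≤ 5.12 ^ ν := by
          rw [sqrt_eq_rpow]
          gcongr
          norm_num
    norm_num at hpow ⊢
    nlinarith
  · have h := Gamma_add_three_halves_le (by linarith : 0 ≤ ν)
    have hΓ' := Gamma_pos_of_pos (by linarith : 0 < ν + 3 / 2)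
    norm_num at h ⊢
    linarith

end GammaBounds

section MaternTruncation

variable {d : ℕ} {ν ℓ : ℝ}

theorem norm_kernelFourier_matern_le (hν : 0 < ν) (hℓ : 0 < ℓ) {ξ : EuclideanSpace ℝ (Fin d)}
    (hξ : ξ ≠ 0) :
    ‖kernelFourier (matern ν ℓ) ξ‖ ≤
      Gamma (ν + d / 2) / Gamma ν / π ^ ((d : ℝ) / 2) * (√(maternRate ν ℓ) / π) ^ (2 * ν) *
        ‖ξ‖ ^ (-(2 * ν + d)) := by
  have hκ := maternRate_pos hν hℓ
  have hξ' : 0 < ‖ξ‖ := norm_pos_iff.2 hξ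
  have hdecay : (maternRate ν ℓ + π ^ 2 * ‖ξ‖ ^ 2) ^ (-(ν + d / 2)) ≤
      (π * ‖ξ‖) ^ (-(2 * ν + d)) := by
    calc (maternRate ν ℓ + π ^ 2 * ‖ξ‖ ^ 2) ^ (-(ν + d / 2))
        ≤ ((π * ‖ξ‖) ^ 2) ^ (-(ν + d / 2)) := by
          refine rpow_le_rpow_of_nonpos (by positivity) ?_ (neg_nonpos.2 (by positivity))
          rw [mul_pow]
          linarith
      _ = (π * ‖ξ‖) ^ (-(2 * ν + d)) := by
          rw [← rpow_natCast, ← rpow_mul (by positivity)]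
          push_cast
          ring_nf
  have hrate : maternRate ν ℓ ^ ν = √(maternRate ν ℓ) ^ (2 * ν) := by
    rw [sqrt_eq_rpow, ← rpow_mul hκ.le]
    ring_nf
  have hpi : π ^ ((d : ℝ) / 2) * π ^ (-(2 * ν + d)) = (π ^ ((d : ℝ) / 2))⁻¹ * (π ^ (2 * ν))⁻¹ := by
    rw [← rpow_neg pi_pos.le, ← rpow_neg pi_pos.le, ← rpow_add pi_pos, ← rpow_add pi_pos]
    ring_nf
  rw [kernelFourier_matern hν hℓ, Complex.norm_real, norm_of_nonneg (by positivity)]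
  calc π ^ ((d : ℝ) / 2) * (maternRate ν ℓ ^ ν * (Gamma (ν + d / 2) / Gamma ν) *
        (maternRate ν ℓ + π ^ 2 * ‖ξ‖ ^ 2) ^ (-(ν + d / 2)))
      ≤ π ^ ((d : ℝ) / 2) * (maternRate ν ℓ ^ ν * (Gamma (ν + d / 2) / Gamma ν) *
        (π * ‖ξ‖) ^ (-(2 * ν + d))) := by gcongr
    _ = _ := by
        rw [mul_rpow pi_pos.le hξ'.le, hrate, div_rpow (sqrt_nonneg _) pi_pos.le]
        linear_combination √(maternRate ν ℓ) ^ (2 * ν) * (Gamma (ν + d / 2) / Gamma ν) *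
          ‖ξ‖ ^ (-(2 * ν + d)) * hpi

theorem rpow_sqrt_maternRate_div_le {R h t : ℝ} (hν : 0 < ν) (hℓ : 0 < ℓ) (hR : 0 < R)
    (hh : 0 < h) (ht : R ^ (1 / (2 * ν)) * (1.6 * √ν / (π * h * ℓ)) ≤ t) :
    (√(maternRate ν ℓ) / π) ^ (2 * ν) * (h * t) ^ (-(2 * ν)) ≤ (R * 5.12 ^ ν)⁻¹ := by
  have hκ := maternRate_pos hν hℓ
  have ht0 : 0 < t := lt_of_lt_of_le (by positivity) ht
  have hsqrt : √(maternRate ν ℓ) = √ν / (√2 * ℓ) := by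
    rw [maternRate, sqrt_div hν.le, sqrt_mul zero_le_two, sqrt_sq hℓ.le]
  have hbase : R ^ (1 / (2 * ν)) * √5.12 ≤ π * (h * t) / √(maternRate ν ℓ) := by
    have h512 : √5.12 = 1.6 * √2 := by
      rw [show (5.12 : ℝ) = 1.6 ^ 2 * 2 by norm_num, sqrt_mul (by norm_num),
        sqrt_sq (by norm_num)]
    rw [le_div_iff₀ (by positivity), h512, hsqrt]
    calc R ^ (1 / (2 * ν)) * (1.6 * √2) * (√ν / (√2 * ℓ))
        = π * (h * (R ^ (1 / (2 * ν)) * (1.6 * √ν / (π * h * ℓ)))) := by field_simp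
      _ ≤ π * (h * t) := by gcongr
  calc (√(maternRate ν ℓ) / π) ^ (2 * ν) * (h * t) ^ (-(2 * ν))
      = ((π * (h * t) / √(maternRate ν ℓ)) ^ (2 * ν))⁻¹ := by
        rw [rpow_neg (by positivity), ← inv_rpow (by positivity),
          ← mul_rpow (by positivity) (by positivity), ← inv_rpow (by positivity)]
        congr 1
        field_simp
    _ ≤ ((R ^ (1 / (2 * ν)) * √5.12) ^ (2 * ν))⁻¹ := by gcongr
    _ = (R * 5.12 ^ ν)⁻¹ := by
        rw [mul_rpow (by positivity) (by positivity), ← rpow_mul hR.le,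
          one_div_mul_cancel (by positivity), rpow_one, sqrt_eq_rpow, ← rpow_mul (by norm_num)]
        ring_nf

theorem matern_truncation_error (hd : d = 1 ∨ d = 2 ∨ d = 3) (hν : 1 / 2 ≤ ν) (hℓ : 0 < ℓ)
    {ε h : ℝ} (hε : 0 < ε) (hh : 0 < h) {m : ℕ}
    (hm : (d * 5 ^ (d - 1) / (π ^ ((d : ℝ) / 2) * ε)) ^ (1 / (2 * ν)) *
      (1.6 * √ν / (π * h * ℓ)) ≤ (m : ℝ)) (x : EuclideanSpace ℝ (Fin d)) :
    Summable (truncationTerm (matern ν ℓ) h m x) ∧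
      ‖∑' j, truncationTerm (matern ν ℓ) h m x j‖ ≤ ε / 2 := by
  have hd0 : 0 < d := by lia
  have hν0 : 0 < ν := by linarith
  have hm0 : 0 < m := Nat.cast_pos.1 (lt_of_lt_of_le (by positivity) hm)
  obtain ⟨hsum, hle⟩ := summable_and_norm_tsum_truncationTerm_le hd0 (by positivity)
    (by positivity) hh (fun ξ hξ => norm_kernelFourier_matern_le hν0 hℓ hξ) hm0 x
  refine ⟨hsum, hle.trans ?_⟩
  have hrate := rpow_sqrt_maternRate_div_le hν0 hℓ (by positivity) hh hm
  have hgamma := two_mul_three_pow_mul_Gamma_le hd hν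
  rw [Gamma_add_one hν0.ne'] at hgamma
  rw [mul_assoc (_ / _ / _)]
  calc 2 * d * 3 ^ (d - 1) / (2 * ν) * (Gamma (ν + d / 2) / Gamma ν / π ^ ((d : ℝ) / 2) *
        ((√(maternRate ν ℓ) / π) ^ (2 * ν) * (h * m) ^ (-(2 * ν))))
      ≤ 2 * d * 3 ^ (d - 1) / (2 * ν) * (Gamma (ν + d / 2) / Gamma ν / π ^ ((d : ℝ) / 2) *
        (d * 5 ^ (d - 1) / (π ^ ((d : ℝ) / 2) * ε) * 5.12 ^ ν)⁻¹) := by gcongr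
    _ = ε / 2 * (2 * 3 ^ (d - 1) * Gamma (ν + d / 2) /
        (5 ^ (d - 1) * (5.12 ^ ν * (ν * Gamma ν)))) := by
        have hpi : 0 < π ^ ((d : ℝ) / 2) := by positivity
        have h5 : (0 : ℝ) < 5.12 ^ ν := by positivity
        generalize (5.12 : ℝ) ^ ν = c at h5 ⊢
        generalize π ^ ((d : ℝ) / 2) = w at hpi ⊢
        field_simp
    _ ≤ ε / 2 :=
        mul_le_of_le_one_right (by positivity) ((div_le_one (by positivity)).2 hgamma)

end MaternTruncation

theorem tsum_matern_translate {d : ℕ} {ν ℓ h : ℝ} (hν : 0 < ν) (hℓ : 0 < ℓ) (hh : 0 < h)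
    (x : EuclideanSpace ℝ (Fin d))
    (hspace : Summable fun n => matern ν ℓ (x + h⁻¹ • latticePoint n))
    (hfreq : Summable (fourierMode (matern ν ℓ) h x)) :
    ((∑' n, matern ν ℓ (x + h⁻¹ • latticePoint n) : ℝ) : ℂ) =
      ∑' j, fourierMode (matern ν ℓ) h x j := by
  have hκ := maternRate_pos hν hℓ
  have := isProbabilityMeasure_gammaMeasure hν hκ
  simp only [matern_eq_gaussianMixture hν hℓ] at hspace hfreq ⊢
  exact tsum_gaussianMixture_translate (ae_gammaMeasure_pos _ _)
    (integrable_rpow_gammaMeasure hν hκ (by positivity)) hh x hspace hfreq.norm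

theorem corollary4p5 (d : ℕ) (hd : d = 1 ∨ d = 2 ∨ d = 3)
    (ν ℓ : ℝ) (hν : 1 / 2 ≤ ν) (hℓ : 0 < ℓ)
    (hℓν : ℓ ≤ (Real.log 2)⁻¹ * Real.sqrt (ν / (2 * d)))
    (ε : ℝ) (hε : 0 < ε)
    (h : ℝ) (hpos : 0 < h)
    (hh₀ : h ≤ (1 + Real.sqrt (8 * ν) * ℓ)⁻¹)
    (hh : h ≤ (1 + ℓ * Real.sqrt (2 * d / ν) * Real.log (d * 3 ^ d / ε))⁻¹) :
    (∀ x ∈ cube d,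
      Summable (aliasingTerm (matern ν ℓ) h x) ∧
        |∑' n, aliasingTerm (matern ν ℓ) h x n| ≤ ε / 2) ∧
    ∀ m : ℕ,
      (d * 5 ^ (d - 1) / (Real.pi ^ ((d : ℝ) / 2) * ε)) ^ (1 / (2 * ν)) *
          (1.6 * Real.sqrt ν / (Real.pi * h * ℓ)) ≤ (m : ℝ) →
        (∀ x : EuclideanSpace ℝ (Fin d),
          Summable (truncationTerm (matern ν ℓ) h m x) ∧
            ‖∑' j, truncationTerm (matern ν ℓ) h m x j‖ ≤ ε / 2) ∧
        ∀ x ∈ cube d,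
          ‖equispacedFourier (matern ν ℓ) h m x - (matern ν ℓ x : ℂ)‖ ≤ ε := by
  refine ⟨fun x => matern_aliasing_error hd hν hℓ hℓν hε hpos hh₀ hh,
    fun m hm => ⟨matern_truncation_error hd hν hℓ hε hpos hm, fun x hx => ?_⟩⟩
  obtain ⟨halias, halias_le⟩ := matern_aliasing_error hd hν hℓ hℓν hε hpos hh₀ hh hx
  obtain ⟨htrunc, htrunc_le⟩ := matern_truncation_error hd hν hℓ hε hpos hm x
  have hpoisson := tsum_matern_translate (by linarith) hℓ hpos x
    (summable_translate_of_aliasingTerm halias) (summable_fourierMode_of_truncationTerm htrunc)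
  calc ‖equispacedFourier (matern ν ℓ) h m x - (matern ν ℓ x : ℂ)‖
      = ‖((∑' n, aliasingTerm (matern ν ℓ) h x n : ℝ) : ℂ) -
          ∑' j, truncationTerm (matern ν ℓ) h m x j‖ := by
        rw [equispacedFourier_sub_eq hpoisson halias htrunc]
    _ ≤ |∑' n, aliasingTerm (matern ν ℓ) h x n| + ‖∑' j, truncationTerm (matern ν ℓ) h m x j‖ := by
        refine (norm_sub_le _ _).trans_eq ?_
        rw [Complex.norm_real, Real.norm_eq_abs]
    _ ≤ ε := by linarith
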